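/- Theorem 4.5. Let $a>0$, let $g_m\in L^2(\mathbb R)$ for $m\in\mathbb Z$, and suppose that the shift-invariant system $(g_m(\cdot-na))_{n,m\in\mathbb Z}$ has a finite upper frame bound, i.e. there is $B<\infty$ with $\sum_{n,m\in\mathbb Z}|\langle f,g_m(\cdot-na)\rangle|^2\le B\|f\|^2$ for all $f\in L^2(\mathbb R)$. Let $S$ be its frame operator, $Sf=\sum_{n,m\in\mathbb Z}\langle f,g_m(\cdot-na)\rangle\,g_m(\cdot-na)$ (unconditional convergence in $L^2(\mathbb R)$). Say that a system $(h_m(\cdot-na))_{n,m\in\mathbb Z}$ with $h_m\in L^2(\mathbb R)$ satisfies the CC-condition if there is $M<\infty$ such that for a.e. $\nu\in\mathbb R$ $$\sum_{k\in\mathbb Z}\Big|\frac1a\sum_{m\in\mathbb Z}\hat h_m(\nu)\,\overline{\hat h_m(\nu-k/a)}\Big|\le M ,$$ where the inner series are required to converge absolutely and $\hat h$ denotes the $L^2$ Fourier transform with the normalization $\hat h(\nu)=\int_{\mathbb R} e^{-2\pi i t\nu}h(t)\,dt$. If $(g_m(\cdot-na))_{n,m\in\mathbb Z}$ satisfies the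 CC-condition, then so does $((Sg_m)(\cdot-na))_{n,m\in\mathbb Z}$. -/

import Mathlib

open MeasureTheory
open scoped FourierTransform ComplexConjugate

noncomputable section

namespace ShiftInvariant

/-- The Hilbert space `L²(ℝ)` of complex-valued functions. -/
abbrev L2R : Type := Lp ℂ 2 (volume : Measure ℝ)

/-- The translation `T_c f(t) = f(t - c)` on `L²(ℝ)`. -/
def translation (c : ℝ) (f : L2R) : L2R :=
  Lp.compMeasurePreserving (fun t : ℝ => t - c) (measurePreserving_sub_right volume c) f

/-- The member `g_m(· - n a)`, with index `p = (n, m)`, of the shift-invariant system generated by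
the sequence `g = (g_m)` with shift parameter `a`. -/
def system (a : ℝ) (g : ℤ → L2R) (p : ℤ × ℤ) : L2R :=
  translation (p.1 * a) (g p.2)

/-- The system has a finite upper frame bound: for some `B < ∞`,
`∑_{n,m} |⟨f, g_m(· - n a)⟩|² ≤ B ‖f‖²` for all `f ∈ L²(ℝ)`. -/
def HasFiniteUpperFrameBound (a : ℝ) (g : ℤ → L2R) : Prop :=
  ∃ B : ℝ, ∀ f : L2R,
    Summable (fun p : ℤ × ℤ => ‖inner ℂ (system a g p) f‖ ^ 2) ∧
      ∑' p : ℤ × ℤ, ‖inner ℂ (system a g p) f‖ ^ 2 ≤ B * ‖f‖ ^ 2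

/-- The frame operator `S f = ∑_{n,m} ⟨f, g_m(· - n a)⟩ g_m(· - n a)`, an unconditional sum
in the norm of `L²(ℝ)`; see `hasSum_frameOperator` for its convergence.
The inner product of Mathlib is conjugate-linear in its first argument. -/
def frameOperator (a : ℝ) (g : ℤ → L2R) (f : L2R) : L2R :=
  ∑' p : ℤ × ℤ, inner ℂ (system a g p) f • system a g p

/-- The CC-condition: for some `B < ∞`, for almost every `ν`,
`∑_k |a⁻¹ ∑_m ĝ_m(ν) conj (ĝ_m(ν - k/a))| ≤ B`, all the series being (absolutely) convergent.
Here `𝓕` is the Fourier transform of `L²(ℝ)`, with kernel `exp(-2πi t ν)`. -/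
def CCCondition (a : ℝ) (g : ℤ → L2R) : Prop :=
  ∃ B : ℝ, ∀ᵐ ν : ℝ,
    (∀ k : ℤ, Summable fun m : ℤ => (𝓕 (g m) : L2R) ν * conj ((𝓕 (g m) : L2R) (ν - k / a))) ∧
    Summable (fun k : ℤ =>
      ‖(1 / a : ℂ) * ∑' m : ℤ, (𝓕 (g m) : L2R) ν * conj ((𝓕 (g m) : L2R) (ν - k / a))‖) ∧
    ∑' k : ℤ,
      ‖(1 / a : ℂ) * ∑' m : ℤ, (𝓕 (g m) : L2R) ν * conj ((𝓕 (g m) : L2R) (ν - k / a))‖ ≤ B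

/-- With a finite upper frame bound the series defining the frame operator converges
unconditionally, so that `frameOperator` never takes a junk value. -/
theorem hasSum_frameOperator {a : ℝ} {g : ℤ → L2R} (h : HasFiniteUpperFrameBound a g) (f : L2R) :
    HasSum (fun p : ℤ × ℤ => inner ℂ (system a g p) f • system a g p) (frameOperator a g f) := by
  obtain ⟨B, hB⟩ := h
  refine Summable.hasSum ?_
  set c : ℤ × ℤ → ℂ := fun p => inner ℂ (system a g p) f with hc
  have key : ∀ s : Finset (ℤ × ℤ), ‖∑ p ∈ s, c p • system a g p‖ ^ 2 ≤
      B * ∑ p ∈ s, ‖c p‖ ^ 2 := by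
    intro s
    set x := ∑ p ∈ s, c p • system a g p with hx
    have h1 : ‖x‖ ^ 2 ≤ ∑ p ∈ s, ‖c p‖ * ‖inner ℂ (system a g p) x‖ := by
      have : (inner ℂ x x : ℂ) = ∑ p ∈ s, conj (c p) * inner ℂ (system a g p) x := by
        conv_lhs => rw [hx, sum_inner]
        simp only [inner_smul_left, ← hx]
      have h2 : ‖x‖ ^ 2 = ‖(inner ℂ x x : ℂ)‖ := by
        rw [inner_self_eq_norm_sq_to_K]; simp
      rw [h2, this]
      refine (norm_sum_le _ _).trans (le_of_eq ?_)
      simp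
    have h3 := Finset.sum_mul_sq_le_sq_mul_sq s (fun p => ‖c p‖)
      (fun p => ‖inner ℂ (system a g p) x‖)
    have h4 : ∑ p ∈ s, ‖inner ℂ (system a g p) x‖ ^ 2 ≤ B * ‖x‖ ^ 2 :=
      ((hB x).1.sum_le_tsum s (fun _ _ => by positivity)).trans (hB x).2
    have h5 : 0 ≤ ∑ p ∈ s, ‖c p‖ ^ 2 := Finset.sum_nonneg fun _ _ => by positivity
    have h6 : (‖x‖ ^ 2) ^ 2 ≤ (∑ p ∈ s, ‖c p‖ ^ 2) * (B * ‖x‖ ^ 2) :=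
      (pow_le_pow_left₀ (by positivity) h1 2).trans
        (h3.trans (mul_le_mul_of_nonneg_left h4 h5))
    rcases eq_or_ne x 0 with h0 | h0
    · have hp : 0 ≤ B * ∑ p ∈ s, ‖c p‖ ^ 2 := by
        rcases le_or_gt 0 B with hb | hb
        · positivity
        · have hf := (tsum_nonneg (fun p => by positivity :
            ∀ p, 0 ≤ ‖inner ℂ (system a g p) f‖ ^ 2)).trans (hB f).2
          have hf0 : f = 0 := by
            by_contra hne
            have : 0 < ‖f‖ ^ 2 := by positivity
            nlinarith
          simp [hc, hf0]
      simpa [h0] using hp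
    · have hpos : 0 < ‖x‖ ^ 2 := by positivity
      nlinarith
  rw [summable_iff_vanishing_norm]
  intro ε hε
  have hs := summable_iff_vanishing_norm.1 (hB f).1 (ε ^ 2 / (|B| + 1)) (by positivity)
  obtain ⟨s, hs⟩ := hs
  refine ⟨s, fun t ht => ?_⟩
  have h1 := hs t ht
  rw [Real.norm_of_nonneg (Finset.sum_nonneg fun _ _ => by positivity)] at h1
  have h5 : 0 ≤ ∑ p ∈ t, ‖c p‖ ^ 2 := Finset.sum_nonneg fun _ _ => by positivity
  have h2 : ‖∑ p ∈ t, c p • system a g p‖ ^ 2 < ε ^ 2 := by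
    rw [lt_div_iff₀ (by positivity)] at h1
    have := key t
    have hb := le_abs_self B
    nlinarith
  exact lt_of_pow_lt_pow_left₀ 2 hε.le h2

end ShiftInvariant

end

namespace ShiftInvariant

open scoped ENNReal NNReal

/-! Fix ν and set X = (ĝ_m(ν - j/a)), with rows indexed by j and columns by m. The dual Gramian G =
a⁻¹ X X* has entries G_{jl} = `gram a g (l - j) (ν - j/a)`. The CC-condition at all the points ν -
j/a says that the rows of G are bounded in ℓ¹ by one constant C.

On the Fourier side the frame operator acts on the fibres (f̂(ν - j/a))_j as multiplication by G
(`fourier_frameOperator`). The system of the S g_m therefore has GX in place of X, and its Gramian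
is a⁻¹ (GX)(GX)* = G G G* = G³, as G is Hermitian. Suprema of ℓ¹ row norms are submultiplicative, so
the rows of G³ are bounded by C³ (`tsum_enorm_gram_mulVec_le`).

The fibre formula comes from Parseval on an interval of length 1/a, where pairings with the
translates by na are Fourier coefficients (`inner_translation`). This treats functions whose
transform lives on one tile; self-adjointness of S extends it to all f. -/

/-! ### Translation as modulation, and Parseval on an interval -/

open Real in
theorem fourier_comp_sub (f : ℝ → ℂ) (c : ℝ) :
    𝓕 (fun t => f (t - c)) = fun ν => (fourierChar (-(c * ν)) : ℂ) * 𝓕 f ν := by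
  ext ν
  rw [Real.fourier_real_eq, Real.fourier_real_eq, ← integral_const_mul,
    ← integral_sub_right_eq_self (fun t => (fourierChar (-(c * ν)) : ℂ) *
      (fourierChar (-(t * ν)) • f t)) c]
  congr 1
  ext t
  rw [Circle.smul_def, Circle.smul_def, smul_eq_mul, smul_eq_mul, ← mul_assoc, ← Circle.coe_mul,
    ← AddChar.map_add_eq_mul]
  congr 4
  ring

theorem memLp_modulation (c : ℝ) (F : L2R) :
    MemLp (fun ν => (Real.fourierChar (-(c * ν)) : ℂ) * F ν) 2 := by
  refine (Lp.memLp F).of_le_mul (c := 1) ?_ (ae_of_all _ fun ν => ?_)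
  · exact Continuous.aestronglyMeasurable (by fun_prop) |>.mul (Lp.aestronglyMeasurable F)
  · rw [norm_mul, Circle.norm_coe]

/-- Modulation `F ↦ exp(-2πi c ·) F` on `L²(ℝ)`. -/
noncomputable def modulation (c : ℝ) (F : L2R) : L2R := (memLp_modulation c F).toLp

theorem coeFn_modulation (c : ℝ) (F : L2R) :
    modulation c F =ᵐ[volume] fun ν => (Real.fourierChar (-(c * ν)) : ℂ) * F ν :=
  (memLp_modulation c F).coeFn_toLp

theorem isometry_modulation (c : ℝ) : Isometry (modulation c) := by
  intro F G
  rw [Lp.edist_def, Lp.edist_def]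
  refine eLpNorm_congr_norm_ae ?_
  filter_upwards [coeFn_modulation c F, coeFn_modulation c G] with ν h1 h2
  rw [Pi.sub_apply, Pi.sub_apply, h1, h2, ← mul_sub, norm_mul, Circle.norm_coe, one_mul]

theorem translation_toLp (c : ℝ) (f : SchwartzMap ℝ ℂ) :
    translation c (f.toLp 2) = (f.compSubConstCLM ℂ c).toLp 2 := by
  apply Lp.ext
  have hm := measurePreserving_sub_right (volume : Measure ℝ) c
  refine (Lp.coeFn_compMeasurePreserving (f.toLp 2) hm).trans ?_
  refine (hm.quasiMeasurePreserving.ae_eq_comp (f.coeFn_toLp 2)).trans ?_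
  exact (SchwartzMap.coeFn_toLp (f.compSubConstCLM ℂ c) 2).symm

/-- Both sides are continuous in f, so density reduces the claim to Schwartz functions, where the
integral formula applies. -/
theorem fourier_translation (c : ℝ) (f : L2R) :
    𝓕 (translation c f) = modulation c (𝓕 f) := by
  have hF : Continuous (fun f : L2R => (𝓕 f : L2R)) :=
    (Lp.fourierTransformₗᵢ ℝ ℂ).continuous
  refine DenseRange.induction_on (p := fun f : L2R => 𝓕 (translation c f) = modulation c (𝓕 f))
    (SchwartzMap.denseRange_toLpCLM (E := ℝ) (F := ℂ) (μ := volume) (p := 2) ENNReal.ofNat_ne_top)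
    f ?_ ?_
  · exact isClosed_eq (hF.comp (Lp.isometry_compMeasurePreserving _).continuous)
      ((isometry_modulation c).continuous.comp hF)
  intro φ
  change 𝓕 (translation c (φ.toLp 2)) = modulation c (𝓕 (φ.toLp 2))
  rw [translation_toLp, SchwartzMap.toLp_fourier_eq, SchwartzMap.toLp_fourier_eq]
  apply Lp.ext
  filter_upwards [coeFn_modulation c ((𝓕 φ).toLp 2), (𝓕 φ).coeFn_toLp 2,
    (𝓕 (φ.compSubConstCLM ℂ c)).coeFn_toLp 2] with ν h1 h2 h3
  rw [h1, h2, h3, SchwartzMap.fourier_coe, SchwartzMap.fourier_coe]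
  exact congrFun (fourier_comp_sub φ c) ν

/-- Parseval's identity for the inner product of two functions on an interval. -/
theorem hasSum_conj_fourierCoeffOn_mul {a b : ℝ} {f g : ℝ → ℂ} (hab : a < b)
    (hf : MemLp f 2 (volume.restrict (Set.Ioc a b)))
    (hg : MemLp g 2 (volume.restrict (Set.Ioc a b))) :
    HasSum (fun i => conj (fourierCoeffOn hab f i) * fourierCoeffOn hab g i)
      ((b - a)⁻¹ • ∫ x in Set.Ioc a b, conj (f x) * g x) := by
  have := Fact.mk (by linarith : 0 < b - a)
  rw [← add_sub_cancel a b] at hf hg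
  have h := hf.memLp_liftIoc.haarAddCircle
  have h' := hg.memLp_liftIoc.haarAddCircle
  convert! fourierBasis.hasSum_inner_mul_inner h.toLp h'.toLp using 1
  · ext i
    rw [← fourierBasis.repr_apply_apply, fourierBasis_repr, ← inner_conj_symm,
      ← fourierBasis.repr_apply_apply, fourierBasis_repr]
    simp [fourierCoeff_congr_ae h.coeFn_toLp, fourierCoeff_congr_ae h'.coeFn_toLp,
      fourierCoeff_liftIoc_eq]
  · rw [L2.inner_def, ← intervalIntegral.integral_of_le hab.le]
    nth_rw 2 [← add_sub_cancel a b]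
    rw [← AddCircle.integral_liftIoc_eq_intervalIntegral, ← AddCircle.integral_haarAddCircle]
    apply integral_congr_ae
    filter_upwards [h.coeFn_toLp, h'.coeFn_toLp] with x hx hx'
    rw [hx, hx']
    simp [AddCircle.liftIoc, mul_comm]

/-! ### Row-sum estimates for infinite matrices -/

theorem ennreal_mul_le_sq_add_sq (x y : ℝ≥0∞) : x * y ≤ x ^ 2 + y ^ 2 := by
  rcases le_total x y with h | h
  · exact (mul_le_mul_left h y).trans (by rw [← sq]; exact le_add_self)
  · exact (mul_le_mul_right h x).trans (by rw [← sq]; exact le_self_add)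

section Schur

variable {x G : ℤ → ℤ → ℂ} {C : ℝ≥0∞}

theorem tsum_enorm_mul_le (hx : ∀ j, ∑' m, ‖x m j‖ₑ ^ 2 ≤ C) (j l : ℤ) :
    ∑' m, ‖x m j‖ₑ * ‖x m l‖ₑ ≤ C + C :=
  calc ∑' m, ‖x m j‖ₑ * ‖x m l‖ₑ ≤ ∑' m, (‖x m j‖ₑ ^ 2 + ‖x m l‖ₑ ^ 2) :=
        ENNReal.tsum_le_tsum fun m => ennreal_mul_le_sq_add_sq _ _
    _ ≤ C + C := by rw [ENNReal.tsum_add]; exact add_le_add (hx j) (hx l)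

/-- Tonelli moves the sum over m inside. The bound gives the column bound for GX when i = k, and in
general the absolute convergence needed to reorder the sums in (GX)(GX)*. -/
theorem tsum_tsum_tsum_enorm_le (hx : ∀ j, ∑' m, ‖x m j‖ₑ ^ 2 ≤ C)
    (hG : ∀ j, ∑' k, ‖G j k‖ₑ ≤ C) (i k : ℤ) :
    ∑' m, (∑' j, ‖G i j‖ₑ * ‖x m j‖ₑ) * ∑' l, ‖G k l‖ₑ * ‖x m l‖ₑ ≤ C * C * (C + C) :=
  calc ∑' m, (∑' j, ‖G i j‖ₑ * ‖x m j‖ₑ) * ∑' l, ‖G k l‖ₑ * ‖x m l‖ₑ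
      = ∑' m, ∑' j, ∑' l, ‖G i j‖ₑ * ‖G k l‖ₑ * (‖x m j‖ₑ * ‖x m l‖ₑ) := by
        congr 1; ext m
        rw [← ENNReal.tsum_mul_right]
        congr 1; ext j
        rw [← ENNReal.tsum_mul_left]
        congr 1; ext l
        ring
    _ = ∑' j, ∑' l, ‖G i j‖ₑ * ‖G k l‖ₑ * ∑' m, ‖x m j‖ₑ * ‖x m l‖ₑ := by
        rw [ENNReal.tsum_comm]
        congr 1; ext j
        rw [ENNReal.tsum_comm]
        congr 1; ext l
        rw [ENNReal.tsum_mul_left]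
    _ ≤ ∑' j, ∑' l, ‖G i j‖ₑ * ‖G k l‖ₑ * (C + C) := by
        gcongr with j l
        exact tsum_enorm_mul_le hx j l
    _ = (∑' j, ‖G i j‖ₑ) * (∑' l, ‖G k l‖ₑ) * (C + C) := by
        simp_rw [ENNReal.tsum_mul_right, ENNReal.tsum_mul_left, ENNReal.tsum_mul_right]
    _ ≤ C * C * (C + C) := by
        gcongr
        · exact hG i
        · exact hG k

theorem tsum_enorm_mulVec_sq_le (hx : ∀ j, ∑' m, ‖x m j‖ₑ ^ 2 ≤ C)
    (hG : ∀ j, ∑' k, ‖G j k‖ₑ ≤ C) (i : ℤ) :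
    ∑' m, ‖∑' j, G i j * x m j‖ₑ ^ 2 ≤ C * C * (C + C) := by
  refine le_trans (ENNReal.tsum_le_tsum fun m => ?_) (tsum_tsum_tsum_enorm_le hx hG i i)
  rw [sq]
  have : ‖∑' j, G i j * x m j‖ₑ ≤ ∑' j, ‖G i j‖ₑ * ‖x m j‖ₑ :=
    enorm_tsum_le_tsum_enorm.trans (by simp [enorm_mul])
  gcongr

/-- If `G = c X X*`, the rows of the matrix `c (G X) (G X)* = G³` are summable. -/
theorem tsum_enorm_gram_mulVec_le (hC : C ≠ ∞) (hx : ∀ j, ∑' m, ‖x m j‖ₑ ^ 2 ≤ C)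
    (hG : ∀ j, ∑' k, ‖G j k‖ₑ ≤ C) (c : ℝ)
    (hGx : ∀ j k, G j k = c * ∑' m, x m j * conj (x m k)) (i : ℤ) :
    ∑' k, ‖(c : ℂ) * ∑' m, (∑' j, G i j * x m j) * conj (∑' l, G k l * x m l)‖ₑ ≤ C * C * C := by
  have hsum : ∀ m j, Summable fun l => ‖G j l * x m l‖ := fun m j => by
    rw [← tsum_enorm_ne_top_iff_summable_norm]
    have hxm : ∀ l, ‖x m l‖ₑ ^ 2 ≤ C := fun l => (ENNReal.le_tsum m).trans (hx l)
    have hxm' : ∀ l, ‖x m l‖ₑ ≤ 1 + C := fun l => by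
      have := ennreal_mul_le_sq_add_sq ‖x m l‖ₑ 1
      rw [mul_one, one_pow] at this
      exact this.trans (by rw [add_comm]; gcongr; exact hxm l)
    refine ne_top_of_le_ne_top (b := C * (1 + C)) (by finiteness) ?_
    calc ∑' l, ‖G j l * x m l‖ₑ ≤ ∑' l, ‖G j l‖ₑ * (1 + C) := by
          gcongr with l
          rw [enorm_mul]
          gcongr
          exact hxm' l
      _ ≤ C * (1 + C) := by rw [ENNReal.tsum_mul_right]; gcongr; exact hG j
  -- G is Hermitian because c is real.
  have hsymm : ∀ j k, ‖G j k‖ₑ = ‖G k j‖ₑ := fun j k => by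
    rw [← RCLike.enorm_conj (G k j), hGx, hGx, map_mul, Complex.conj_tsum]
    simp [mul_comm]
  -- Since conj G_{kl} = G_{lk}, the right-hand side is the (i, k) entry of G³.
  have hform : ∀ k, (c : ℂ) * ∑' m, (∑' j, G i j * x m j) * conj (∑' l, G k l * x m l) =
      ∑' p : ℤ × ℤ, G i p.1 * conj (G k p.2) * G p.1 p.2 := fun k => by
    have h1 : ∀ m, (∑' j, G i j * x m j) * conj (∑' l, G k l * x m l) =
        ∑' p : ℤ × ℤ, G i p.1 * conj (G k p.2) * (x m p.1 * conj (x m p.2)) := fun m => by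
      rw [Complex.conj_tsum, tsum_mul_tsum_of_summable_norm (hsum m i)
        (by simpa using hsum m k)]
      congr 1; ext p
      rw [map_mul]; ring
    simp_rw [h1]
    rw [Summable.tsum_comm, ← tsum_mul_left]
    · congr 1; ext p
      rw [tsum_mul_left, hGx p.1 p.2]; ring
    · refine Summable.of_enorm (ne_top_of_le_ne_top ?_ (le_trans (le_of_eq ?_)
        (tsum_tsum_tsum_enorm_le hx hG i k)))
      · finiteness
      · rw [ENNReal.tsum_prod', ENNReal.tsum_comm]
        refine tsum_congr fun m => ?_
        rw [ENNReal.tsum_prod', ← ENNReal.tsum_mul_right]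
        refine tsum_congr fun j => ?_
        rw [← ENNReal.tsum_mul_left]
        refine tsum_congr fun l => ?_
        simp only [Function.uncurry, enorm_mul, RCLike.enorm_conj]; ring
  calc ∑' k, ‖(c : ℂ) * ∑' m, (∑' j, G i j * x m j) * conj (∑' l, G k l * x m l)‖ₑ
      ≤ ∑' k, ∑' j, ∑' l, ‖G i j‖ₑ * ‖G j l‖ₑ * ‖G l k‖ₑ := by
        gcongr with k
        rw [hform]
        refine enorm_tsum_le_tsum_enorm.trans (le_of_eq ?_)
        rw [ENNReal.tsum_prod']
        congr 1; ext j; congr 1; ext l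
        rw [enorm_mul, enorm_mul, RCLike.enorm_conj, hsymm k l]; ring
    _ = ∑' j, ∑' l, ‖G i j‖ₑ * ‖G j l‖ₑ * ∑' k, ‖G l k‖ₑ := by
        rw [ENNReal.tsum_comm]
        congr 1; ext j
        rw [ENNReal.tsum_comm]
        congr 1; ext l
        rw [ENNReal.tsum_mul_left]
    _ ≤ ∑' j, ∑' l, ‖G i j‖ₑ * ‖G j l‖ₑ * C := by
        gcongr with j l
        exact hG l
    _ = ∑' j, ‖G i j‖ₑ * (∑' l, ‖G j l‖ₑ) * C := by
        simp_rw [ENNReal.tsum_mul_right, ENNReal.tsum_mul_left]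
    _ ≤ ∑' j, ‖G i j‖ₑ * C * C := by
        gcongr with j
        exact hG j
    _ ≤ C * C * C := by
        rw [ENNReal.tsum_mul_right, ENNReal.tsum_mul_right]
        gcongr
        exact hG i

end Schur

/-! ### The CC-condition as bounds in [0, ∞] -/

/-- The entries `a⁻¹ ∑_m ĝ_m(ν) conj (ĝ_m(ν - k/a))` of the dual Gramian. -/
noncomputable def gram (a : ℝ) (g : ℤ → L2R) (k : ℤ) (ν : ℝ) : ℂ :=
  (1 / a : ℂ) * ∑' m : ℤ, (𝓕 (g m) : L2R) ν * conj ((𝓕 (g m) : L2R) (ν - k / a))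

theorem ae_forall_sub {P : ℝ → Prop} (a : ℝ) (h : ∀ᵐ ν : ℝ, P ν) :
    ∀ᵐ ν : ℝ, ∀ j : ℤ, P (ν - j / a) :=
  ae_all_iff.2 fun j =>
    (measurePreserving_sub_right volume ((j : ℝ) / a)).quasiMeasurePreserving.ae h

/-- The first bound is the k = 0 term of the CC-condition. Conversely it forces absolute convergence
of every series over m, which the second bound alone would not, since a divergent `tsum` is 0. -/
theorem ccCondition_iff {a : ℝ} (ha : 0 < a) (g : ℤ → L2R) :
    CCCondition a g ↔ ∃ C : ℝ≥0, (∀ᵐ ν : ℝ, ∑' m, ‖(𝓕 (g m) : L2R) ν‖ₑ ^ 2 ≤ C) ∧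
      ∀ᵐ ν : ℝ, ∑' k, ‖gram a g k ν‖ₑ ≤ C := by
  constructor
  · rintro ⟨B, hB⟩
    -- B bounds the row sum; a * B bounds ∑ |ĝ_m|², after clearing the factor 1/a from the diagonal
    -- term.
    refine ⟨(max B (a * B)).toNNReal, ?_, ?_⟩
    · filter_upwards [hB] with ν ⟨h1, h2, h3⟩
      have h0 := h1 0
      simp only [Int.cast_zero, zero_div, sub_zero] at h0
      have h4 := (h2.le_tsum 0 fun _ _ => norm_nonneg _).trans h3
      simp only [Int.cast_zero, zero_div, sub_zero] at h4
      have h5 : Summable fun m => ‖(𝓕 (g m) : L2R) ν‖ ^ 2 := by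
        simpa [sq] using h0.norm
      have h6 : (∑' m, (𝓕 (g m) : L2R) ν * conj ((𝓕 (g m) : L2R) ν)) =
          ((∑' m, ‖(𝓕 (g m) : L2R) ν‖ ^ 2 : ℝ) : ℂ) := by
        rw [Complex.ofReal_tsum]
        simp [Complex.mul_conj, Complex.normSq_eq_norm_sq]
      have h7 : ∑' m, ‖(𝓕 (g m) : L2R) ν‖ ^ 2 ≤ a * B := by
        rw [h6, norm_mul, Complex.norm_real,
          Real.norm_of_nonneg (tsum_nonneg fun _ => by positivity)] at h4
        simp only [one_div, norm_inv, Complex.norm_real, Real.norm_of_nonneg ha.le] at h4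
        rwa [inv_mul_le_iff₀ ha] at h4
      have h8 : ∑' m, ‖(𝓕 (g m) : L2R) ν‖ₑ ^ 2 =
          ENNReal.ofReal (∑' m, ‖(𝓕 (g m) : L2R) ν‖ ^ 2) := by
        rw [ENNReal.ofReal_tsum_of_nonneg (fun _ => by positivity) h5]
        simp [ENNReal.ofReal_pow]
      rw [h8]
      exact ENNReal.ofReal_le_ofReal (h7.trans (le_max_right _ _))
    · filter_upwards [hB] with ν ⟨_, h2, h3⟩
      change Summable fun k => ‖gram a g k ν‖ at h2
      have h8 : ∑' k, ‖gram a g k ν‖ₑ = ENNReal.ofReal (∑' k, ‖gram a g k ν‖) := by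
        rw [ENNReal.ofReal_tsum_of_nonneg (fun _ => norm_nonneg _) h2]
        simp only [ofReal_norm]
      rw [h8]
      exact ENNReal.ofReal_le_ofReal (h3.trans (le_max_left _ _))
  · rintro ⟨C, h1, h2⟩
    refine ⟨C, ?_⟩
    filter_upwards [ae_forall_sub a h1, h2] with ν hν h2
    have hs : Summable fun k => ‖gram a g k ν‖ :=
      tsum_enorm_ne_top_iff_summable_norm.1 (ne_top_of_le_ne_top ENNReal.coe_ne_top h2)
    refine ⟨fun k => ?_, hs, ?_⟩
    · have := tsum_enorm_mul_le (x := fun m j => (𝓕 (g m) : L2R) (ν - j / a)) hν 0 k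
      simp only [Int.cast_zero, zero_div, sub_zero] at this
      refine Summable.of_enorm (ne_top_of_le_ne_top ?_ (le_trans (le_of_eq ?_) this))
      · finiteness
      · simp [enorm_mul]
    · have h8 : ∑' k, ‖gram a g k ν‖ₑ = ENNReal.ofReal (∑' k, ‖gram a g k ν‖) := by
        rw [ENNReal.ofReal_tsum_of_nonneg (fun _ => norm_nonneg _) hs]
        simp only [ofReal_norm]
      rw [h8] at h2
      exact (ENNReal.ofReal_le_ofReal_iff C.2).1 (h2.trans_eq ENNReal.ofReal_coe_nnreal.symm)

/-! ### Pairings with translates as Fourier coefficients -/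

/-- The shift by k/a changes the exponent by -2πi n k only, so every tile sees the same characters
of the circle of length 1/a. -/
theorem conj_fourierChar_sub {a : ℝ} (ha : 0 < a) (n k : ℤ) (T ν : ℝ) (hT : T = 1 / a) :
    conj (Real.fourierChar (-(n * a * (ν - k / a))) : ℂ) = fourier n (ν : AddCircle T) := by
  have ha' : (a : ℂ) ≠ 0 := by exact_mod_cast ha.ne'
  rw [fourier_coe_apply, Real.fourierChar_apply, ← Complex.exp_conj,
    Complex.exp_eq_exp_iff_exists_int]
  refine ⟨-(n * k), ?_⟩
  subst hT
  simp only [map_mul, Complex.conj_ofReal, Complex.conj_I]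
  push_cast
  field_simp
  ring

theorem integral_eq_setIntegral_sub {s : Set ℝ} (c : ℝ) {h : ℝ → ℂ}
    (h0 : ∀ᵐ ν : ℝ, ν + c ∉ s → h ν = 0) : ∫ ν, h ν = ∫ ν in s, h (ν - c) := by
  rw [← integral_sub_right_eq_self h c,
    setIntegral_eq_integral_of_ae_compl_eq_zero (s := s)]
  have := (measurePreserving_sub_right (volume : Measure ℝ) c).quasiMeasurePreserving.ae h0
  filter_upwards [this] with ν hν
  simpa using hν

/-- By Plancherel the pairing is an integral over one tile against a character. The factor 1/a
undoes the averaging in `fourierCoeffOn`. -/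
theorem inner_translation {a : ℝ} (ha : 0 < a) {α β : ℝ} (hβ : β - α = 1 / a) (hαβ : α < β)
    (n k : ℤ) (G u : L2R)
    (hu : ∀ᵐ ν : ℝ, ν + k / a ∉ Set.Ioc α β → (𝓕 u : L2R) ν = 0) :
    inner ℂ (translation (n * a) G) u = (1 / a : ℂ) * fourierCoeffOn hαβ
      (fun ν => conj ((𝓕 G : L2R) (ν - k / a)) * (𝓕 u : L2R) (ν - k / a)) (-n) := by
  have ha' : (a : ℂ) ≠ 0 := by exact_mod_cast ha.ne'
  rw [← Lp.inner_fourier_eq, fourier_translation, L2.inner_def,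
    integral_eq_setIntegral_sub (s := Set.Ioc α β) (k / a),
    fourierCoeffOn_eq_integral, intervalIntegral.integral_of_le hαβ.le, hβ]
  · simp only [neg_neg, one_div, Complex.real_smul, inv_inv]
    rw [← mul_assoc, inv_mul_cancel₀ ha', one_mul]
    have hm := (measurePreserving_sub_right (volume : Measure ℝ)
      (k / a)).quasiMeasurePreserving.ae (coeFn_modulation (n * a) (𝓕 G))
    refine setIntegral_congr_ae measurableSet_Ioc ?_
    filter_upwards [hm] with ν hν _
    rw [hν, ← conj_fourierChar_sub ha n k _ ν rfl]
    simp only [RCLike.inner_apply, map_mul, smul_eq_mul]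
    ring
  · filter_upwards [hu] with ν hν h
    rw [hν h, inner_zero_right]

theorem memLp_conj_mul {G u : L2R} {C : ℝ} (hG : ∀ᵐ ν : ℝ, ‖G ν‖ ≤ C) (c : ℝ) :
    MemLp (fun ν => conj (G (ν - c)) * u (ν - c)) 2 := by
  have : MemLp (fun ν => conj (G ν) * u ν) 2 := by
    refine (Lp.memLp u).of_le_mul (c := C) ?_ ?_
    · exact (Complex.continuous_conj.comp_aestronglyMeasurable (Lp.aestronglyMeasurable G)).mul
        (Lp.aestronglyMeasurable u)
    · filter_upwards [hG] with ν hν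
      rw [norm_mul, RCLike.norm_conj]
      gcongr
  exact this.comp_measurePreserving (measurePreserving_sub_right (volume : Measure ℝ) c)

theorem hasSum_inner_translation_mul_inner {a : ℝ} (ha : 0 < a) {α β : ℝ} (hβ : β - α = 1 / a)
    (hαβ : α < β) (k : ℤ) {G u v : L2R} {C : ℝ}
    (hG : ∀ᵐ ν : ℝ, ‖(𝓕 G : L2R) ν‖ ≤ C)
    (hu : ∀ᵐ ν : ℝ, ν + k / a ∉ Set.Ioc α β → (𝓕 u : L2R) ν = 0)
    (hv : ∀ᵐ ν : ℝ, ν ∉ Set.Ioc α β → (𝓕 v : L2R) ν = 0) :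
    HasSum (fun n : ℤ => inner ℂ (translation (n * a) G) u * inner ℂ v (translation (n * a) G))
      (∫ ν in Set.Ioc α β, conj ((𝓕 v : L2R) ν) * ((1 / a : ℂ) * ((𝓕 G : L2R) ν *
        conj ((𝓕 G : L2R) (ν - k / a)))) * (𝓕 u : L2R) (ν - k / a)) := by
  have ha' : (a : ℂ) ≠ 0 := by exact_mod_cast ha.ne'
  have hP := hasSum_conj_fourierCoeffOn_mul hαβ
    ((memLp_conj_mul (u := 𝓕 v) hG ((0 : ℤ) / a)).restrict _)
    ((memLp_conj_mul (u := 𝓕 u) hG (k / a)).restrict _)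
  -- The coefficients carry the index -n. Of the two factors 1/a, one cancels (β - α)⁻¹ = a in
  -- Parseval.
  have h := ((Equiv.neg ℤ).hasSum_iff.2 hP).mul_left ((1 / a : ℂ) * (1 / a : ℂ))
  convert! h using 1
  · ext n
    rw [inner_translation ha hβ hαβ n k G u hu, ← inner_conj_symm,
      inner_translation ha hβ hαβ n 0 G v (by simpa using hv)]
    simp only [Function.comp_apply, Equiv.neg_apply, map_mul, map_div₀, map_one,
      Complex.conj_ofReal]
    ring
  · rw [hβ, one_div a, inv_inv, Complex.real_smul, ← mul_assoc, ← integral_const_mul]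
    congr 1
    ext ν
    simp only [Int.cast_zero, zero_div, sub_zero, map_mul, Complex.conj_conj]
    field_simp

theorem hasSum_inner_frameOperator {a : ℝ} {g : ℤ → L2R} (hB : HasFiniteUpperFrameBound a g)
    (u v : L2R) :
    HasSum (fun p : ℤ × ℤ => inner ℂ (system a g p) u * inner ℂ v (system a g p))
      (inner ℂ v (frameOperator a g u)) := by
  have := (hasSum_frameOperator hB u).mapL (innerSL ℂ v)
  simpa [inner_smul_right] using this

/-- Self-adjointness lets f be cut into tiles inside one integral, without using continuity of S. -/
theorem inner_frameOperator_left {a : ℝ} {g : ℤ → L2R} (hB : HasFiniteUpperFrameBound a g)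
    (u v : L2R) : inner ℂ (frameOperator a g v) u = inner ℂ v (frameOperator a g u) := by
  rw [← (hasSum_inner_frameOperator hB u v).tsum_eq, ← inner_conj_symm,
    ← (hasSum_inner_frameOperator hB v u).tsum_eq, Complex.conj_tsum]
  congr 1
  ext p
  rw [map_mul, inner_conj_symm, inner_conj_symm, mul_comm]

theorem lintegral_enorm_sq_ne_top (F : L2R) : ∫⁻ ν : ℝ, ‖F ν‖ₑ ^ 2 ≠ ∞ := by
  have := (memLp_two_iff_integrable_sq_norm (Lp.aestronglyMeasurable F)).1 (Lp.memLp F)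
  simpa [hasFiniteIntegral_iff_enorm, enorm_pow] using this.2.ne

theorem lintegral_sub_enorm_sq (F : L2R) (c : ℝ) (s : Set ℝ) :
    ∫⁻ ν in s, ‖F (ν - c)‖ₑ ^ 2 = ∫⁻ ν in (fun ν => ν + c) ⁻¹' s, ‖F ν‖ₑ ^ 2 := by
  have := (measurePreserving_add_right (volume : Measure ℝ) c).setLIntegral_comp_preimage_emb
    (measurableEmbedding_addRight c) (fun ν => ‖F (ν - c)‖ₑ ^ 2) s
  simpa using this.symm

theorem aestronglyMeasurable_comp_sub (F : L2R) (c : ℝ) :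
    AEStronglyMeasurable (fun ν => F (ν - c)) (volume : Measure ℝ) :=
  (Lp.aestronglyMeasurable F).comp_measurePreserving (measurePreserving_sub_right volume c)

/-! ### Tiling the line by intervals of length 1/a -/

section Tiles

variable {a : ℝ} {α β : ℝ}

theorem pairwise_disjoint_tiles (ha : 0 < a) (hβ : β - α = 1 / a) :
    Pairwise (Function.onFun Disjoint
      fun k : ℤ => (fun ν : ℝ => ν + k / a) ⁻¹' Set.Ioc α β) := by
  intro k l hkl
  refine Set.disjoint_left.2 fun ν h1 h2 => hkl ?_
  have hβ' : β = α + 1 / a := by linarith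
  subst hβ'
  refine (existsUnique_add_zsmul_mem_Ioc (one_div_pos.2 ha) ν α).unique ?_ ?_
  · simpa only [zsmul_eq_mul, mul_one_div, Set.mem_preimage] using h1
  · simpa only [zsmul_eq_mul, mul_one_div, Set.mem_preimage] using h2

theorem iUnion_tiles (ha : 0 < a) (hβ : β - α = 1 / a) :
    ⋃ k : ℤ, (fun ν : ℝ => ν + k / a) ⁻¹' Set.Ioc α β = Set.univ := by
  have hβ' : β = α + 1 / a := by linarith
  subst hβ'
  refine Set.eq_univ_of_forall fun ν => Set.mem_iUnion.2 ?_
  obtain ⟨k, hk, -⟩ := existsUnique_add_zsmul_mem_Ioc (one_div_pos.2 ha) ν α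
  exact ⟨k, by simpa only [zsmul_eq_mul, mul_one_div, Set.mem_preimage] using hk⟩

theorem measurableSet_tile (k : ℤ) :
    MeasurableSet ((fun ν : ℝ => ν + k / a) ⁻¹' Set.Ioc α β) :=
  measurableSet_Ioc.preimage (by fun_prop)

theorem tsum_lintegral_tiles (ha : 0 < a) (hβ : β - α = 1 / a) (F : L2R) :
    ∑' k : ℤ, ∫⁻ ν in Set.Ioc α β, ‖F (ν - k / a)‖ₑ ^ 2 = ∫⁻ ν, ‖F ν‖ₑ ^ 2 := by
  simp_rw [lintegral_sub_enorm_sq]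
  rw [← lintegral_iUnion measurableSet_tile (pairwise_disjoint_tiles ha hβ),
    iUnion_tiles ha hβ, setLIntegral_univ]

end Tiles

/-! ### The frame operator on fibres -/

section Fiberization

variable {a : ℝ} {g : ℤ → L2R} {C : ℝ≥0} {α β : ℝ}

theorem norm_fourier_le (h1 : ∀ᵐ ν : ℝ, ∑' m, ‖(𝓕 (g m) : L2R) ν‖ₑ ^ 2 ≤ C) (m : ℤ) :
    ∀ᵐ ν : ℝ, ‖(𝓕 (g m) : L2R) ν‖ ≤ 1 + C := by
  filter_upwards [h1] with ν hν
  have h2 := (ENNReal.le_tsum m).trans hν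
  rw [enorm_eq_nnnorm, ← ENNReal.coe_pow, ENNReal.coe_le_coe] at h2
  have h3 : ‖(𝓕 (g m) : L2R) ν‖ ^ 2 ≤ C := by exact_mod_cast h2
  nlinarith [sq_nonneg (‖(𝓕 (g m) : L2R) ν‖ - 1)]

theorem tsum_enorm_mul_sub_le (h1 : ∀ᵐ ν : ℝ, ∑' m, ‖(𝓕 (g m) : L2R) ν‖ₑ ^ 2 ≤ C) (k : ℤ) :
    ∀ᵐ ν : ℝ, ∑' m, ‖(𝓕 (g m) : L2R) ν * conj ((𝓕 (g m) : L2R) (ν - k / a))‖ₑ ≤ C + C := by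
  filter_upwards [ae_forall_sub a h1] with ν hν
  have := tsum_enorm_mul_le (x := fun m j => (𝓕 (g m) : L2R) (ν - j / a)) hν 0 k
  simpa [enorm_mul] using this

theorem aestronglyMeasurable_fourier_mul_sub (m k : ℤ) :
    AEStronglyMeasurable
      (fun ν => (𝓕 (g m) : L2R) ν * conj ((𝓕 (g m) : L2R) (ν - k / a)))
      (volume : Measure ℝ) :=
  (Lp.aestronglyMeasurable _).mul
    (Complex.continuous_conj.comp_aestronglyMeasurable (aestronglyMeasurable_comp_sub _ _))

theorem aestronglyMeasurable_gram (k : ℤ) :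
    AEStronglyMeasurable (gram a g k) volume := by
  exact (AEMeasurable.tsum fun m =>
    (aestronglyMeasurable_fourier_mul_sub m k).aemeasurable).aestronglyMeasurable.const_mul _

/-- For each m the sum over n is Parseval. The sum over m enters the integral because ∑_m |ĝ_m(ν)
ĝ_m(ν - k/a)| is essentially bounded. -/
theorem inner_frameOperator_of_support (ha : 0 < a) (hβ : β - α = 1 / a) (hαβ : α < β)
    (hB : HasFiniteUpperFrameBound a g)
    (h1 : ∀ᵐ ν : ℝ, ∑' m, ‖(𝓕 (g m) : L2R) ν‖ₑ ^ 2 ≤ C) (k : ℤ) {u v : L2R}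
    (hu : ∀ᵐ ν : ℝ, ν + k / a ∉ Set.Ioc α β → (𝓕 u : L2R) ν = 0)
    (hv : ∀ᵐ ν : ℝ, ν ∉ Set.Ioc α β → (𝓕 v : L2R) ν = 0) :
    inner ℂ v (frameOperator a g u) = ∫ ν in Set.Ioc α β,
      conj ((𝓕 v : L2R) ν) * gram a g k ν * (𝓕 u : L2R) (ν - k / a) := by
  have hswap : HasSum (fun q : ℤ × ℤ => inner ℂ (translation (q.2 * a) (g q.1)) u *
      inner ℂ v (translation (q.2 * a) (g q.1))) (inner ℂ v (frameOperator a g u)) :=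
    (Equiv.prodComm ℤ ℤ).hasSum_iff.2 (hasSum_inner_frameOperator hB u v)
  have hfib := fun m =>
    hasSum_inner_translation_mul_inner ha hβ hαβ k (norm_fourier_le h1 m) hu hv
  have hs := hswap.prod_fiberwise hfib
  have hmeas : ∀ m, AEStronglyMeasurable (fun ν => conj ((𝓕 v : L2R) ν) *
      ((1 / a : ℂ) * ((𝓕 (g m) : L2R) ν * conj ((𝓕 (g m) : L2R) (ν - k / a)))) *
        (𝓕 u : L2R) (ν - k / a)) (volume.restrict (Set.Ioc α β)) := fun m =>
    (((Complex.continuous_conj.comp_aestronglyMeasurable (Lp.aestronglyMeasurable _)).mul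
      ((aestronglyMeasurable_fourier_mul_sub m k).const_mul _)).mul
        (aestronglyMeasurable_comp_sub _ _)).restrict
  rw [← hs.tsum_eq, ← integral_tsum hmeas]
  · congr 1
    ext ν
    rw [tsum_mul_right, tsum_mul_left, tsum_mul_left, gram]
  · rw [← lintegral_tsum fun m => (hmeas m).enorm]
    refine ne_top_of_le_ne_top (b := ∫⁻ ν in Set.Ioc α β, ‖(1 / a : ℂ)‖ₑ * (C + C) *
      (‖(𝓕 v : L2R) ν‖ₑ ^ 2 + ‖(𝓕 u : L2R) (ν - k / a)‖ₑ ^ 2)) ?_ (lintegral_mono_ae ?_)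
    · rw [lintegral_const_mul' _ _ (by finiteness),
        lintegral_add_left' ((Lp.aestronglyMeasurable _).enorm.pow_const 2).restrict,
        lintegral_sub_enorm_sq]
      have e1 := ne_top_of_le_ne_top (lintegral_enorm_sq_ne_top (𝓕 v))
        (setLIntegral_le_lintegral (Set.Ioc α β) _)
      have e2 := ne_top_of_le_ne_top (lintegral_enorm_sq_ne_top (𝓕 u))
        (setLIntegral_le_lintegral ((fun ν : ℝ => ν + k / a) ⁻¹' Set.Ioc α β) _)
      finiteness
    · filter_upwards [ae_restrict_of_ae (tsum_enorm_mul_sub_le (a := a) h1 k)] with ν hν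
      simp_rw [enorm_mul _ ((𝓕 u : L2R) (ν - k / a)), enorm_mul (conj ((𝓕 v : L2R) ν)),
        enorm_mul (1 / a : ℂ), RCLike.enorm_conj]
      rw [ENNReal.tsum_mul_right, ENNReal.tsum_mul_left, ENNReal.tsum_mul_left]
      calc _ = ‖(1 / a : ℂ)‖ₑ * (∑' m, ‖(𝓕 (g m) : L2R) ν *
            conj ((𝓕 (g m) : L2R) (ν - k / a))‖ₑ) *
            (‖(𝓕 v : L2R) ν‖ₑ * ‖(𝓕 u : L2R) (ν - k / a)‖ₑ) := by ring
        _ ≤ _ := by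
          gcongr
          exact ennreal_mul_le_sq_add_sq _ _

/-- A Schur-type bound: split w |F| ≤ w² + |F|², then use the row sum for w² and the entrywise bound
with the tiling for |F|². It serves for w = |v̂| and for w = 1. -/
theorem lintegral_mul_tsum_gram_le (ha : 0 < a) (hβ : β - α = 1 / a)
    (h2 : ∀ᵐ ν : ℝ, ∑' k, ‖gram a g k ν‖ₑ ≤ C) (F : L2R) {w : ℝ → ℝ≥0∞} (hw : AEMeasurable w) :
    ∫⁻ ν in Set.Ioc α β, ∑' k : ℤ, w ν * (‖gram a g k ν‖ₑ * ‖F (ν - k / a)‖ₑ) ≤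
      C * (∫⁻ ν in Set.Ioc α β, w ν ^ 2) + C * ∫⁻ ν, ‖F ν‖ₑ ^ 2 := by
  have hm : ∀ k : ℤ, AEMeasurable (fun ν => ‖F (ν - k / a)‖ₑ ^ 2)
      (volume.restrict (Set.Ioc α β)) := fun k =>
    ((aestronglyMeasurable_comp_sub F (k / a)).enorm.pow_const 2).restrict
  calc _ ≤ ∫⁻ ν in Set.Ioc α β, (C * w ν ^ 2 + C * ∑' k : ℤ, ‖F (ν - k / a)‖ₑ ^ 2) := by
        refine lintegral_mono_ae ?_
        filter_upwards [ae_restrict_of_ae h2] with ν hν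
        have hk : ∀ k, ‖gram a g k ν‖ₑ ≤ C := fun k => (ENNReal.le_tsum k).trans hν
        calc ∑' k : ℤ, w ν * (‖gram a g k ν‖ₑ * ‖F (ν - k / a)‖ₑ)
            ≤ ∑' k : ℤ, (‖gram a g k ν‖ₑ * w ν ^ 2 + C * ‖F (ν - k / a)‖ₑ ^ 2) := by
              gcongr with k
              calc _ = ‖gram a g k ν‖ₑ * (w ν * ‖F (ν - k / a)‖ₑ) := by ring
                _ ≤ ‖gram a g k ν‖ₑ * (w ν ^ 2 + ‖F (ν - k / a)‖ₑ ^ 2) := by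
                  gcongr
                  exact ennreal_mul_le_sq_add_sq _ _
                _ ≤ _ := by
                  rw [mul_add]
                  gcongr
                  exact hk k
          _ ≤ _ := by
              rw [ENNReal.tsum_add, ENNReal.tsum_mul_right, ENNReal.tsum_mul_left]
              gcongr
    _ = _ := by
        rw [lintegral_add_left' ((hw.pow_const 2).const_mul _).restrict,
          lintegral_const_mul' _ _ ENNReal.coe_ne_top, lintegral_const_mul' _ _ ENNReal.coe_ne_top,
          lintegral_tsum hm, tsum_lintegral_tiles ha hβ]

/-- Write ⟨v, S f⟩ = ⟨S v, f⟩ as an integral over the line and split it into tiles. On each tile f̂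
may be replaced by its restriction û; moving S back reduces to the one-tile formula. -/
theorem inner_frameOperator_eq (ha : 0 < a) (hβ : β - α = 1 / a) (hαβ : α < β)
    (hB : HasFiniteUpperFrameBound a g)
    (h1 : ∀ᵐ ν : ℝ, ∑' m, ‖(𝓕 (g m) : L2R) ν‖ₑ ^ 2 ≤ C)
    (h2 : ∀ᵐ ν : ℝ, ∑' k, ‖gram a g k ν‖ₑ ≤ C) (f : L2R) {v : L2R}
    (hv : ∀ᵐ ν : ℝ, ν ∉ Set.Ioc α β → (𝓕 v : L2R) ν = 0) :
    inner ℂ v (frameOperator a g f) = ∫ ν in Set.Ioc α β,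
      conj ((𝓕 v : L2R) ν) * ∑' k : ℤ, gram a g k ν * (𝓕 f : L2R) (ν - k / a) := by
  have hmeas : ∀ k : ℤ, AEStronglyMeasurable (fun ν => conj ((𝓕 v : L2R) ν) *
      (gram a g k ν * (𝓕 f : L2R) (ν - k / a))) (volume.restrict (Set.Ioc α β)) := fun k =>
    ((Complex.continuous_conj.comp_aestronglyMeasurable (Lp.aestronglyMeasurable _)).mul
      ((aestronglyMeasurable_gram k).mul (aestronglyMeasurable_comp_sub _ _))).restrict
  have hint : ∀ k : ℤ, ∫ ν in (fun ν : ℝ => ν + k / a) ⁻¹' Set.Ioc α β,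
      inner ℂ ((𝓕 (frameOperator a g v) : L2R) ν) ((𝓕 f : L2R) ν) =
      ∫ ν in Set.Ioc α β, conj ((𝓕 v : L2R) ν) *
        (gram a g k ν * (𝓕 f : L2R) (ν - k / a)) := fun k => by
    set s := (fun ν : ℝ => ν + k / a) ⁻¹' Set.Ioc α β with hs
    have hsm : MeasurableSet s := measurableSet_tile k
    obtain ⟨u, hu⟩ : ∃ u : L2R, 𝓕 u = ((Lp.memLp (𝓕 f : L2R)).indicator hsm).toLp _ :=
      (Lp.fourierTransformₗᵢ ℝ ℂ).surjective _
    have hu' : (𝓕 u : L2R) =ᵐ[volume] s.indicator (𝓕 f : L2R) := by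
      rw [hu]; exact MemLp.coeFn_toLp _
    have hsupp : ∀ᵐ ν : ℝ, ν + k / a ∉ Set.Ioc α β → (𝓕 u : L2R) ν = 0 := by
      filter_upwards [hu'] with ν hν hn
      rw [hν]
      exact Set.indicator_of_notMem (s := s) hn _
    have e1 := inner_frameOperator_of_support ha hβ hαβ hB h1 k hsupp hv
    rw [← inner_frameOperator_left hB, ← Lp.inner_fourier_eq, L2.inner_def] at e1
    calc _ = ∫ ν, inner ℂ ((𝓕 (frameOperator a g v) : L2R) ν) ((𝓕 u : L2R) ν) := by
          rw [← integral_indicator hsm]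
          refine integral_congr_ae ?_
          filter_upwards [hu'] with ν hν
          rw [hν]
          by_cases h : ν ∈ s <;> simp [h]
      _ = _ := by
          rw [e1]
          refine setIntegral_congr_ae measurableSet_Ioc ?_
          filter_upwards [(measurePreserving_sub_right (volume : Measure ℝ)
            (k / a)).quasiMeasurePreserving.ae hu'] with ν hν hJ
          rw [hν, Set.indicator_of_mem (by simpa [hs] using hJ), mul_assoc]
  have hsum := hasSum_integral_iUnion (μ := volume)
    (f := fun ν => inner ℂ ((𝓕 (frameOperator a g v) : L2R) ν) ((𝓕 f : L2R) ν))
    (fun k => measurableSet_tile k) (pairwise_disjoint_tiles ha hβ)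
    (L2.integrable_inner (𝕜 := ℂ) (𝓕 (frameOperator a g v) : L2R) (𝓕 f : L2R)).integrableOn
  rw [iUnion_tiles ha hβ, setIntegral_univ, ← L2.inner_def, Lp.inner_fourier_eq,
    inner_frameOperator_left hB] at hsum
  rw [← hsum.tsum_eq]
  simp_rw [hint]
  rw [← integral_tsum hmeas]
  · simp_rw [tsum_mul_left]
  · rw [← lintegral_tsum fun k => (hmeas k).enorm]
    simp_rw [enorm_mul, RCLike.enorm_conj]
    refine ne_top_of_le_ne_top ?_ (lintegral_mul_tsum_gram_le ha hβ h2 (𝓕 f)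
      (Lp.aestronglyMeasurable (𝓕 v : L2R)).enorm)
    have e1 := ne_top_of_le_ne_top (lintegral_enorm_sq_ne_top (𝓕 v))
        (setLIntegral_le_lintegral (Set.Ioc α β) _)
    have e2 := lintegral_enorm_sq_ne_top (𝓕 f)
    finiteness

theorem integrableOn_tsum_gram_mul (ha : 0 < a) (hβ : β - α = 1 / a)
    (h2 : ∀ᵐ ν : ℝ, ∑' k, ‖gram a g k ν‖ₑ ≤ C) (F : L2R) :
    IntegrableOn (fun ν => ∑' k : ℤ, gram a g k ν * F (ν - k / a)) (Set.Ioc α β) := by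
  have hmeas : ∀ k : ℤ, AEStronglyMeasurable (fun ν => gram a g k ν * F (ν - k / a))
      (volume.restrict (Set.Ioc α β)) := fun k =>
    ((aestronglyMeasurable_gram k).mul (aestronglyMeasurable_comp_sub _ _)).restrict
  have hfin : ∫⁻ ν in Set.Ioc α β, ∑' k : ℤ, ‖gram a g k ν * F (ν - k / a)‖ₑ ≠ ∞ := by
    have := lintegral_mul_tsum_gram_le (α := α) ha hβ h2 F (w := 1) aemeasurable_const
    simp only [Pi.one_apply, one_mul, one_pow, lintegral_one, Measure.restrict_apply_univ,
      Real.volume_Ioc, ← enorm_mul] at this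
    have e2 := lintegral_enorm_sq_ne_top F
    exact ne_top_of_le_ne_top (by finiteness) this
  exact ⟨(AEMeasurable.tsum fun k => (hmeas k).aemeasurable).aestronglyMeasurable,
    (lintegral_mono fun ν => enorm_tsum_le_tsum_enorm).trans_lt hfin.lt_top⟩

/-- Testing against v with v̂ the indicator of a measurable subset of the interval identifies the
two integrands almost everywhere. -/
theorem fourier_frameOperator_ae_restrict (ha : 0 < a) (hβ : β - α = 1 / a) (hαβ : α < β)
    (hB : HasFiniteUpperFrameBound a g)
    (h1 : ∀ᵐ ν : ℝ, ∑' m, ‖(𝓕 (g m) : L2R) ν‖ₑ ^ 2 ≤ C)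
    (h2 : ∀ᵐ ν : ℝ, ∑' k, ‖gram a g k ν‖ₑ ≤ C) (f : L2R) :
    (𝓕 (frameOperator a g f) : L2R) =ᵐ[volume.restrict (Set.Ioc α β)]
      fun ν => ∑' k : ℤ, gram a g k ν * (𝓕 f : L2R) (ν - k / a) := by
  refine Integrable.ae_eq_of_forall_setIntegral_eq _ _
    ((Lp.memLp _).restrict _ |>.integrable one_le_two)
    (integrableOn_tsum_gram_mul ha hβ h2 (𝓕 f)) fun s hs _ => ?_
  have hE : MeasurableSet (s ∩ Set.Ioc α β) := hs.inter measurableSet_Ioc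
  have hEv : volume (s ∩ Set.Ioc α β) ≠ ∞ :=
    ne_top_of_le_ne_top (by simp) (measure_mono Set.inter_subset_right)
  obtain ⟨v, hv⟩ : ∃ v : L2R, 𝓕 v = indicatorConstLp 2 hE hEv (1 : ℂ) :=
    (Lp.fourierTransformₗᵢ ℝ ℂ).surjective _
  have hv' : (𝓕 v : L2R) =ᵐ[volume] (s ∩ Set.Ioc α β).indicator fun _ => (1 : ℂ) := by
    rw [hv]; exact indicatorConstLp_coeFn
  have key := inner_frameOperator_eq ha hβ hαβ hB h1 h2 f (v := v) (by
    filter_upwards [hv'] with ν hν hn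
    rw [hν, Set.indicator_of_notMem fun h => hn h.2])
  rw [← Lp.inner_fourier_eq, hv, L2.inner_indicatorConstLp_one, ← hv] at key
  rw [Measure.restrict_restrict hs, key, ← integral_indicator measurableSet_Ioc,
    ← integral_indicator hE]
  refine integral_congr_ae ?_
  filter_upwards [hv'] with ν hν
  by_cases hJ : ν ∈ Set.Ioc α β <;> by_cases hν' : ν ∈ s <;> simp [Set.indicator, hν, hJ, hν']

/-- On the Fourier side the frame operator acts through the dual Gramian. -/
theorem fourier_frameOperator (ha : 0 < a) (hB : HasFiniteUpperFrameBound a g)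
    (h1 : ∀ᵐ ν : ℝ, ∑' m, ‖(𝓕 (g m) : L2R) ν‖ₑ ^ 2 ≤ C)
    (h2 : ∀ᵐ ν : ℝ, ∑' k, ‖gram a g k ν‖ₑ ≤ C) (f : L2R) :
    (𝓕 (frameOperator a g f) : L2R) =ᵐ[volume]
      fun ν => ∑' k : ℤ, gram a g k ν * (𝓕 f : L2R) (ν - k / a) := by
  -- The base interval was arbitrary; the choices α = -j/a cover the line.
  have h : ∀ j : ℤ, ∀ᵐ ν : ℝ, ν ∈ Set.Ioc (-(j / a)) (-(j / a) + 1 / a) →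
      (𝓕 (frameOperator a g f) : L2R) ν =
        ∑' k : ℤ, gram a g k ν * (𝓕 f : L2R) (ν - k / a) := fun j =>
    (ae_restrict_iff' measurableSet_Ioc).1 (fourier_frameOperator_ae_restrict ha (by ring)
      (by have := one_div_pos.2 ha; linarith) hB h1 h2 f)
  filter_upwards [ae_all_iff.2 h] with ν hν
  obtain ⟨j, hj⟩ := Set.mem_iUnion.1 ((iUnion_tiles (α := 0) (β := 1 / a) ha (by ring)).ge
    (Set.mem_univ ν))
  exact hν j ⟨by linarith [hj.1], by linarith [hj.2]⟩

end Fiberization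

end ShiftInvariant

/-- If a shift-invariant system has a finite upper frame bound, the CC-condition passes from it to its
image under the frame operator. -/
theorem theorem4p5 (a : ℝ) (ha : 0 < a) (g : ℤ → ShiftInvariant.L2R)
    (hB : ShiftInvariant.HasFiniteUpperFrameBound a g)
    (hCC : ShiftInvariant.CCCondition a g) :
    ShiftInvariant.CCCondition a (fun m => ShiftInvariant.frameOperator a g (g m)) := by
  open ShiftInvariant in
  obtain ⟨C, h1, h2⟩ := (ccCondition_iff ha g).1 hCC
  -- The fibre formula at ν - j/a, reindexed by l = k + j, is row j of the product GX.
  have key : ∀ᵐ ν : ℝ, ∀ m (j : ℤ), (𝓕 (frameOperator a g (g m)) : L2R) (ν - j / a) =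
      ∑' l : ℤ, gram a g (l - j) (ν - j / a) * (𝓕 (g m) : L2R) (ν - l / a) := by
    refine ae_all_iff.2 fun m => ?_
    filter_upwards [ae_forall_sub a (fourier_frameOperator ha hB h1 h2 (g m))] with ν hν j
    rw [hν j]
    refine Eq.trans (tsum_congr fun k => ?_) ((Equiv.addRight j).tsum_eq _)
    simp only [Equiv.coe_addRight, add_sub_cancel_right]
    congr 2
    push_cast
    ring
  have hrow : ∀ᵐ ν : ℝ, ∀ j : ℤ, ∑' l : ℤ, ‖gram a g (l - j) (ν - j / a)‖ₑ ≤ C := by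
    filter_upwards [ae_forall_sub a h2] with ν hν j
    rw [← (Equiv.addRight j).tsum_eq]
    simpa using hν j
  rw [ccCondition_iff ha]
  -- The two constants bound the squared ℓ² norm over m of row 0 of GX and the ℓ¹ norm of row 0 of
  -- G³.
  refine ⟨max (C * C * (C + C)) (C * C * C), ?_, ?_⟩
  · filter_upwards [key, ae_forall_sub a h1, hrow] with ν hk hx hG
    have := tsum_enorm_mulVec_sq_le (x := fun m j => (𝓕 (g m) : L2R) (ν - j / a))
      (G := fun j l => gram a g (l - j) (ν - j / a)) hx hG 0
    simp_rw [← hk] at this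
    simp only [Int.cast_zero, zero_div, sub_zero] at this
    exact this.trans (by push_cast; exact le_max_left _ _)
  · filter_upwards [key, ae_forall_sub a h1, hrow] with ν hk hx hG
    have := tsum_enorm_gram_mulVec_le (x := fun m j => (𝓕 (g m) : L2R) (ν - j / a))
      (G := fun j l => gram a g (l - j) (ν - j / a)) ENNReal.coe_ne_top hx hG (1 / a)
      (fun j k => by
        simp only [gram]
        push_cast
        congr 1
        refine tsum_congr fun m => ?_
        congr 3
        ring) 0
    simp_rw [← hk] at this
    simp only [Int.cast_zero, zero_div, sub_zero] at this
    refine le_trans (le_of_eq ?_) (this.trans (by push_cast; exact le_max_right _ _))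
    simp [gram]
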